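/- Let $\mathbb{S}$ be the sphere of purely imaginary unit quaternions and let $i,j\in\mathbb{S}$ be orthogonal. Write $\mathbb{C}_i=\mathbb{R}+\mathbb{R}i$ (identified with $\mathbb{C}$) and $\mathbb{T}_i$ for its unit circle; every quaternion is uniquely $p=p^{(1)}+p^{(2)}j$ with $p^{(1)},p^{(2)}\in\mathbb{C}_i$, and we put $$\chi_i(p)=\begin{bmatrix}p^{(1)}&p^{(2)}\\-\overline{p^{(2)}}&\overline{p^{(1)}}\end{bmatrix}\in\mathbb{C}_i^{2\times2}.$$ *Matrix side.* Let $M_i$ be a positive (i.e. positive-semidefinite-valued) $\mathbb{C}_i^{2\times2}$-valued Borel measure on $\mathbb{T}_i$. For $f,g\in\mathbb{C}_i^{2\times2}[z]$ put $$\langle f,g\rangle_L=\int_0^{2\pi} f(e^{i\theta})\,\mathrm{d}M_i(\theta)\,g(e^{i\theta})^*,\qquad \langle f,g\rangle_R=\int_0^{2\pi} g(e^{i\theta})^*\,\mathrm{d}M_i(\theta)\,f(e^{i\theta}),$$ and assume that $M_i$ is non-trivial: $\|f\|_L=(\operatorname{Tr}\langle f,f\rangle_L)^{1/2}$ and $\|f\|_R=(\operatorname{Tr}\langle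 f,f\rangle_R)^{1/2}$ vanish only for $f=0$. The left-orthonormal polynomials of $M_i$ are the polynomials $\varphi^L_n(z)=\kappa^L_nz^n+\dots$ of degree at most $n$ $(n\ge0)$ with $\langle\varphi_n^L,\varphi_m^L\rangle_L=\delta_{nm}I_2$, normalised by $\kappa_0^L>0$ and $\kappa_{n+1}^L(\kappa_n^L)^{-1}>0$ (positive definite). The right-orthonormal polynomials $\varphi_n^R(z)=\kappa^R_nz^n+\dots$ are defined in the same way from $\langle\cdot,\cdot\rangle_R$, normalised by $\kappa_0^R>0$ and $(\kappa_n^R)^{-1}\kappa^R_{n+1}>0$. *Quaternionic side.* A sequence $c=(c_n)_{n\in\mathbb{Z}}$ in $\mathbb{H}$ is a non-trivial positive definite sequence if for all $n\ge0$ the matrix $T_n(c)=[c_{\ell-k}]_{k,\ell=0}^n$ satisfies $\xi^*T_n(c)\xi>0$ for all nonzero $\xi\in\mathbb{H}^{n+1}$. Let $\mathbb{H}[p]^L$ be the polynomials $\sum_kp^k\varphi_k$ and $\mathbb{H}[p]^R$ the polynomials $\sum_k\varphi_kp^k$ with $\varphi_k\in\mathbb{H}$. On $\mathbb{H}[p]^L$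 put $\langle\varphi,\psi\rangle_R=\sum_{k,\ell}\overline{\psi_\ell}\,c_{k-\ell}\,\varphi_k$, and on $\mathbb{H}[p]^R$ put $\langle\varphi,\psi\rangle_L=\sum_{k,\ell}\varphi_k\,c_{k-\ell}\,\overline{\psi_\ell}$. The right-orthonormal polynomials $(\psi_n^R)_{n\ge0}$ of $c$ are obtained from $1,p,p^2,\dots\in\mathbb{H}[p]^L$ (a right $\mathbb{H}$-module) by Gram–Schmidt for $\langle\cdot,\cdot\rangle_R$, and the left-orthonormal polynomials $(\psi_n^L)_{n\ge0}$ from $1,p,p^2,\dots\in\mathbb{H}[p]^R$ (a left $\mathbb{H}$-module) by Gram–Schmidt for $\langle\cdot,\cdot\rangle_L$, all with positive real leading coefficients. Let $$\Phi_i^L\Big(\sum_kp^k\varphi_k\Big)=\sum_k\chi_i(\varphi_k)z^k=\Phi_i^R\Big(\sum_k\varphi_kp^k\Big).$$ **Theorem.** Suppose that all moments $C_n=\int_0^{2\pi}e^{in\theta}\,\mathrm{d}M_i(\theta)$, $n\in\mathbb{Z}$, lie in the image of $\chi_i$, and let $c=(\chi_i^{-1}(C_n))_{n\in\mathbb{Z}}$.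 Then $c$ is a non-trivial positive definite sequence, the orthonormal polynomials $(\varphi_n^L)$ and $(\varphi_n^R)$ of $M_i$ exist and are unique, and for all $n\ge0$ $$\varphi_n^L=\Phi_i^R(\psi_n^L)\qquad\text{and}\qquad\varphi_n^R=\Phi_i^L(\psi_n^R).$$ -/

import Mathlib

open MeasureTheory Polynomial
open scoped Quaternion Matrix ComplexOrder

noncomputable section

namespace QOPUC

/-! ### Quaternions and the embedding `χ_i`

For an imaginary unit `i` the plane `ℂ_i = ℝ + ℝ i` is identified with `ℂ` through
`a + b I ↦ a + b i`, and the circle `𝕋_i` correspondingly with `Circle`. -/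

/-- The sphere `𝕊` of purely imaginary quaternions of norm one. -/
def imagUnits : Set ℍ[ℝ] := {q | q.re = 0 ∧ ‖q‖ = 1}

/-- The identification of `ℂ` with `ℂ_i ⊆ ℍ`. -/
def slice (i : ℍ[ℝ]) (z : ℂ) : ℍ[ℝ] := (z.re : ℍ[ℝ]) + (z.im : ℍ[ℝ]) * i

/-- The component `p⁽¹⁾ ∈ ℂ_i ≅ ℂ` in `p = p⁽¹⁾ + p⁽²⁾ j`. -/
def comp₁ (i p : ℍ[ℝ]) : ℂ := ⟨p.re, inner ℝ p i⟩

/-- The component `p⁽²⁾ ∈ ℂ_i ≅ ℂ` in `p = p⁽¹⁾ + p⁽²⁾ j`. -/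
def comp₂ (i j p : ℍ[ℝ]) : ℂ := ⟨inner ℝ p j, inner ℝ p (i * j)⟩

/-- The two components do decompose `p`, when `i, j ∈ 𝕊` are orthogonal. -/
theorem slice_comp {i j : ℍ[ℝ]} (hi : i ∈ imagUnits) (hj : j ∈ imagUnits)
    (hij : inner ℝ i j = 0) (p : ℍ[ℝ]) :
    slice i (comp₁ i p) + slice i (comp₂ i j p) * j = p := by
  obtain ⟨hi0, hi1⟩ := hi
  obtain ⟨hj0, hj1⟩ := hj
  have hi2 : inner ℝ i i = 1 := by rw [real_inner_self_eq_norm_sq, hi1, one_pow]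
  have hj2 : inner ℝ j j = 1 := by rw [real_inner_self_eq_norm_sq, hj1, one_pow]
  simp only [Quaternion.inner_def, Quaternion.re_mul, Quaternion.re_star, Quaternion.imI_star,
    Quaternion.imJ_star, Quaternion.imK_star, hi0, hj0] at hi2 hj2 hij
  -- the three units form an orthogonal matrix, so that its columns are orthonormal too
  have key : !![i.imI, i.imJ, i.imK; j.imI, j.imJ, j.imK;
      i.imJ * j.imK - i.imK * j.imJ, i.imK * j.imI - i.imI * j.imK,
      i.imI * j.imJ - i.imJ * j.imI]ᵀ * !![i.imI, i.imJ, i.imK; j.imI, j.imJ, j.imK;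
      i.imJ * j.imK - i.imK * j.imJ, i.imK * j.imI - i.imI * j.imK,
      i.imI * j.imJ - i.imJ * j.imI] = 1 := by
    rw [mul_eq_one_comm]
    ext a b
    fin_cases a <;> fin_cases b <;>
      simp [Matrix.mul_apply, Fin.sum_univ_three]
    · linear_combination hi2
    · linear_combination hij
    · ring
    · linear_combination hij
    · linear_combination hj2
    · ring
    · ring
    · ring
    · linear_combination (j.imI ^ 2 + j.imJ ^ 2 + j.imK ^ 2) * hi2 + hj2 -
        (i.imI * j.imI + i.imJ * j.imJ + i.imK * j.imK) * hij
  have e : ∀ a b : Fin 3, _ := fun a b => congrFun (congrFun key a) b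
  have e00 := e 0 0
  have e01 := e 0 1
  have e02 := e 0 2
  have e11 := e 1 1
  have e12 := e 1 2
  have e22 := e 2 2
  simp [Matrix.mul_apply, Fin.sum_univ_three] at e00 e01 e02 e11 e12 e22
  ext <;> simp [slice, comp₁, comp₂, Quaternion.inner_def, hi0, hj0]
  · linear_combination
      (p.imI * (i.imJ * j.imK - i.imK * j.imJ) + p.imJ * (i.imK * j.imI - i.imI * j.imK) +
        p.imK * (i.imI * j.imJ - i.imJ * j.imI) -
        p.re * (i.imI * j.imI + i.imJ * j.imJ + i.imK * j.imK)) * -1 * hij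
  · linear_combination p.imI * e00 + p.imJ * e01 + p.imK * e02 -
      p.re * (i.imJ * j.imK - i.imK * j.imJ) * hij
  · linear_combination p.imI * e01 + p.imJ * e11 + p.imK * e12 -
      p.re * (i.imK * j.imI - i.imI * j.imK) * hij
  · linear_combination p.imI * e02 + p.imJ * e12 + p.imK * e22 -
      p.re * (i.imI * j.imJ - i.imJ * j.imI) * hij

/-- The embedding `χ_i : ℍ → ℂ_i^{2×2} ≅ ℂ^{2×2}`. -/
def chi (i j p : ℍ[ℝ]) : Matrix (Fin 2) (Fin 2) ℂ :=
  !![comp₁ i p, comp₂ i j p; -star (comp₂ i j p), star (comp₁ i p)]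

theorem chi_zero (i j : ℍ[ℝ]) : chi i j 0 = 0 := by
  have h1 : comp₁ i 0 = 0 := by apply Complex.ext <;> simp [comp₁]
  have h2 : comp₂ i j 0 = 0 := by apply Complex.ext <;> simp [comp₂]
  ext a b
  fin_cases a <;> fin_cases b <;> simp [chi, h1, h2]

theorem chi_injective {i j : ℍ[ℝ]} (hi : i ∈ imagUnits) (hj : j ∈ imagUnits)
    (hij : inner ℝ i j = 0) : Function.Injective (chi i j) := by
  intro p q h
  have h1 : comp₁ i p = comp₁ i q := by simpa [chi] using congrFun (congrFun h 0) 0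
  have h2 : comp₂ i j p = comp₂ i j q := by simpa [chi] using congrFun (congrFun h 0) 1
  rw [← slice_comp hi hj hij p, ← slice_comp hi hj hij q, h1, h2]

/-! ### Quaternionic polynomials

A slice hyperholomorphic polynomial is represented by its coefficients, an element of `ℍ[X]`. -/

/-- Left-slice hyperholomorphic polynomials `p ↦ ∑ p ^ k * φ_k` (coefficients on the right). -/
abbrev PolyL := Polynomial ℍ[ℝ]

/-- Right-slice hyperholomorphic polynomials `p ↦ ∑ φ_k * p ^ k` (coefficients on the left). -/
abbrev PolyR := Polynomial ℍ[ℝ]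

/-- `2 × 2` matrix-valued analytic polynomials `z ↦ ∑ P_k z ^ k`. -/
abbrev MatPoly := Polynomial (Matrix (Fin 2) (Fin 2) ℂ)

/-- `Φ_i^L (∑ p ^ k φ_k) = ∑ χ_i(φ_k) z ^ k`. -/
def PhiL (i j : ℍ[ℝ]) (f : PolyL) : MatPoly := f.sum fun k a => monomial k (chi i j a)

/-- `Φ_i^R (∑ φ_k p ^ k) = ∑ χ_i(φ_k) z ^ k`. -/
def PhiR (i j : ℍ[ℝ]) (f : PolyR) : MatPoly := f.sum fun k a => monomial k (chi i j a)

/-! ### Positive definite sequences and quaternionic orthonormal polynomials -/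

/-- The Toeplitz matrix `T_n(c)`, with entry `c_{l-k}` in row `k` and column `l`. -/
def toeplitz (c : ℤ → ℍ[ℝ]) (n : ℕ) : Matrix (Fin (n + 1)) (Fin (n + 1)) ℍ[ℝ] :=
  Matrix.of fun k l => c ((l : ℤ) - (k : ℤ))

/-- A quaternionic matrix is positive definite if `ξ* A ξ > 0` (real and positive) for all
nonzero `ξ`. -/
def QPosDef {n : ℕ} (A : Matrix (Fin n) (Fin n) ℍ[ℝ]) : Prop :=
  ∀ ξ : Fin n → ℍ[ℝ], ξ ≠ 0 → ∃ r : ℝ, 0 < r ∧ star ξ ⬝ᵥ (A *ᵥ ξ) = (r : ℍ[ℝ])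

/-- Non-trivial positive definite sequences of quaternions. -/
def IsNontrivialPosDef (c : ℤ → ℍ[ℝ]) : Prop := ∀ n, QPosDef (toeplitz c n)

/-- `⟨φ, ψ⟩_R = ψ̂* T_N(c) φ̂ = ∑ conj(ψ_l) c_{k-l} φ_k`. -/
def qInnerR (c : ℤ → ℍ[ℝ]) (φ ψ : PolyL) : ℍ[ℝ] :=
  ψ.sum fun l b => φ.sum fun k a => star b * c ((k : ℤ) - (l : ℤ)) * a

/-- `⟨φ, ψ⟩_L = ∑ φ_k c_{k-l} conj(ψ_l)`. -/
def qInnerL (c : ℤ → ℍ[ℝ]) (φ ψ : PolyR) : ℍ[ℝ] :=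
  φ.sum fun k a => ψ.sum fun l b => a * c ((k : ℤ) - (l : ℤ)) * star b

/-- Left-orthonormal polynomials `ψ_n^L`: Gram-Schmidt on `1, p, p², …` for `⟨·,·⟩_L`, in the left
`ℍ`-module of polynomials with coefficients on the left. -/
def psiL (c : ℤ → ℍ[ℝ]) (n : ℕ) : PolyR :=
  let u : PolyR := X ^ n - ∑ k : Fin n, C (qInnerL c (X ^ n) (psiL c k)) * psiL c k
  (√(qInnerL c u u).re)⁻¹ • u
termination_by n
decreasing_by all_goals exact k.2

/-- Right-orthonormal polynomials `ψ_n^R`: Gram-Schmidt on `1, p, p², …` for `⟨·,·⟩_R`, in the right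
`ℍ`-module of polynomials with coefficients on the right. -/
def psiR (c : ℤ → ℍ[ℝ]) (n : ℕ) : PolyL :=
  let u : PolyL := X ^ n - ∑ k : Fin n, psiR c k * C (qInnerR c (X ^ n) (psiR c k))
  (√(qInnerR c u u).re)⁻¹ • u
termination_by n
decreasing_by all_goals exact k.2

/-! ### Matrix-valued measures and their orthonormal polynomials -/

instance : MeasurableSpace Circle := borel Circle

instance : BorelSpace Circle := ⟨rfl⟩

/-- Matrix-valued (countably additive) Borel measures on the unit circle. -/
abbrev MatMeasure := VectorMeasure Circle (Matrix (Fin 2) (Fin 2) ℂ)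

/-- The complex measure in position `(a, b)`. -/
def MatMeasure.entry (M : MatMeasure) (a b : Fin 2) : ComplexMeasure Circle :=
  VectorMeasure.mapRange M (Matrix.entryAddMonoidHom ℂ a b) (continuous_id.matrix_elem a b)

/-- The integral of a complex function against a complex measure. -/
def cIntegral (ν : ComplexMeasure Circle) (f : Circle → ℂ) : ℂ :=
  VectorMeasure.integral ν f (ContinuousLinearMap.mul ℝ ℂ)

/-- `∫ F dM G`, with matrix products in this order. -/
def matIntegral (M : MatMeasure) (F G : Circle → Matrix (Fin 2) (Fin 2) ℂ) :
    Matrix (Fin 2) (Fin 2) ℂ :=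
  Matrix.of fun a b => ∑ k, ∑ l, cIntegral (M.entry k l) fun z => F z a k * G z l b

/-- The moments `C_n = ∫ e^{inθ} dM(θ)`. -/
def moment (M : MatMeasure) (n : ℤ) : Matrix (Fin 2) (Fin 2) ℂ :=
  matIntegral M (fun z => ((z : ℂ) ^ n) • (1 : Matrix (Fin 2) (Fin 2) ℂ)) fun _ => 1

/-- `M` is positive: its values are positive semidefinite matrices. -/
def IsPositive (M : MatMeasure) : Prop := ∀ s, MeasurableSet s → (M s).PosSemidef

/-- Value of a matrix polynomial at a point of the circle. -/
def matEval (P : MatPoly) (z : Circle) : Matrix (Fin 2) (Fin 2) ℂ :=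
  P.sum fun k A => ((z : ℂ) ^ k) • A

/-- `⟨f, g⟩_L = ∫ f dM g*`. -/
def matInnerL (M : MatMeasure) (f g : MatPoly) : Matrix (Fin 2) (Fin 2) ℂ :=
  matIntegral M (matEval f) fun z => (matEval g z)ᴴ

/-- `⟨f, g⟩_R = ∫ g* dM f`. -/
def matInnerR (M : MatMeasure) (f g : MatPoly) : Matrix (Fin 2) (Fin 2) ℂ :=
  matIntegral M (fun z => (matEval g z)ᴴ) (matEval f)

/-- `‖f‖_L = (Tr ∫ f dM f*)^{1/2}`. -/
def matNormL (M : MatMeasure) (f : MatPoly) : ℝ := √(matInnerL M f f).trace.re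

/-- `‖f‖_R = (Tr ∫ f* dM f)^{1/2}`. -/
def matNormR (M : MatMeasure) (f : MatPoly) : ℝ := √(matInnerR M f f).trace.re

/-- `M` is non-trivial: `‖·‖_L` and `‖·‖_R` are definite on matrix polynomials. -/
def IsNontrivial (M : MatMeasure) : Prop :=
  (∀ f, matNormL M f = 0 → f = 0) ∧ (∀ f, matNormR M f = 0 → f = 0)

/-- `φ` is the sequence of left-orthonormal matrix polynomials of `M`: `φ_n` has degree at most `n`,
the sequence is orthonormal for `⟨·,·⟩_L`, and the coefficients `κ_n` of `z ^ n` in `φ_n` are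
normalised by `κ_0 > 0` and `κ_{n+1} κ_n⁻¹ > 0`. -/
structure IsLeftOrthonormal (M : MatMeasure) (φ : ℕ → MatPoly) : Prop where
  natDegree_le : ∀ n, (φ n).natDegree ≤ n
  orthonormal : ∀ n m, matInnerL M (φ n) (φ m) = if n = m then 1 else 0
  posDef_zero : ((φ 0).coeff 0).PosDef
  posDef_succ : ∀ n, ((φ (n + 1)).coeff (n + 1) * ((φ n).coeff n)⁻¹).PosDef

/-- `φ` is the sequence of right-orthonormal matrix polynomials of `M`: as above, for `⟨·,·⟩_R`, with
`κ_0 > 0` and `κ_n⁻¹ κ_{n+1} > 0`. -/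
structure IsRightOrthonormal (M : MatMeasure) (φ : ℕ → MatPoly) : Prop where
  natDegree_le : ∀ n, (φ n).natDegree ≤ n
  orthonormal : ∀ n m, matInnerR M (φ n) (φ m) = if n = m then 1 else 0
  posDef_zero : ((φ 0).coeff 0).PosDef
  posDef_succ : ∀ n, (((φ n).coeff n)⁻¹ * (φ (n + 1)).coeff (n + 1)).PosDef

end QOPUC

end

/-!
All four inner products are one and the same form. For a sequence `C` in a star ring `R` let
`toeplitzForm C f g = ∑ f_k C_{k-l} (g_l)*` on `R[X]`. Integrating trigonometric polynomials term by
term gives `⟨f, g⟩_L = toeplitzForm C f g` for the moments `C` of the measure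
(`matInnerL_eq_toeplitzForm`), and the quaternionic `⟨·, ·⟩_L` is the form of `c` by definition.
Taking adjoints of all coefficients (`coeffStar`) turns right inner products, Gram-Schmidt processes
and orthonormal polynomials into left ones for the reflected sequence `n ↦ C_{-n}`, so that only left
objects have to be studied.

The map `χ_i` is an injective star homomorphism, so applying it to coefficients carries the form of
`c` to the form of `C = χ_i ∘ c` (`toeplitzForm_map`). The moments of a Hermitian-valued measure
satisfy `C_n* = C_{-n}`, hence so does `c`, and `toeplitzForm c f f` is self-adjoint, that is, a real
number `r`. As `χ_i(r) = r I` has trace `2 r`, non-triviality of the measure forces `r > 0` for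
`f ≠ 0` (`toeplitzForm_self_pos`). This is positive definiteness of `c`, and it makes Gram-Schmidt
work over `ℍ` (`psiL_spec`). The image of the resulting polynomials under `χ_i` is orthonormal with
positive scalar leading coefficients, so it satisfies the matrix normalisation.

It remains to see that the normalised matrix orthonormal polynomials are unique
(`IsToeplitzOrthonormal.unique`). If `φ` and `ψ` are two such sequences which agree below `n`, choose
`A` such that the leading terms of `φ_n` and `A ψ_n` agree; the difference has degree less than `n`
and is orthogonal to all polynomials of such degree, so `φ_n = A ψ_n`. Orthonormality makes `A`
unitary, and the normalisation says that `A` maps a positive definite matrix to a positive definite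
one, which forces `A = 1` by uniqueness of the polar decomposition.
-/

noncomputable section

namespace QOPUC

/-! ### The Toeplitz form of a sequence -/

section ToeplitzForm

variable {R : Type*} [Ring R] [StarRing R]

/-- The sesquilinear form `∑ f_k C_{k-l} (g_l)*` on polynomials over a star ring `R` which is given
by a sequence `C` in `R`. It is left `R`-linear in `f`. -/
def toeplitzForm (C : ℤ → R) (f g : R[X]) : R :=
  f.sum fun k a => g.sum fun l b => a * C ((k : ℤ) - (l : ℤ)) * star b

/-- The polynomial whose coefficients are the adjoints of those of `f`. This map is additive and
exchanges the left and the right module structure of `R[X]`. -/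
def coeffStar (f : R[X]) : R[X] := f.sum fun k a => monomial k (star a)

theorem coeff_coeffStar (f : R[X]) (n : ℕ) : (coeffStar f).coeff n = star (f.coeff n) := by
  rw [coeffStar, Polynomial.sum_def, finsetSum_coeff]
  simp only [coeff_monomial]
  rw [Finset.sum_ite_eq' f.support n]
  split_ifs with h
  · rfl
  · rw [notMem_support_iff.1 h, star_zero]

theorem coeffStar_coeffStar (f : R[X]) : coeffStar (coeffStar f) = f := by
  ext n
  simp [coeff_coeffStar]

theorem natDegree_coeffStar_le {f : R[X]} {n : ℕ} (hf : f.natDegree ≤ n) :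
    (coeffStar f).natDegree ≤ n := by
  rw [natDegree_le_iff_coeff_eq_zero] at hf ⊢
  intro N hN
  rw [coeff_coeffStar, hf N hN, star_zero]

theorem toeplitzForm_eq_sum_range (C : ℤ → R) {f g : R[X]} {N : ℕ} (hf : f.natDegree < N)
    (hg : g.natDegree < N) :
    toeplitzForm C f g = ∑ k ∈ Finset.range N, ∑ l ∈ Finset.range N,
      f.coeff k * C ((k : ℤ) - (l : ℤ)) * star (g.coeff l) := by
  rw [toeplitzForm, sum_over_range' _ _ N hf]
  · refine Finset.sum_congr rfl fun k _ => ?_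
    rw [sum_over_range' _ _ N hg]
    simp
  · simp [Polynomial.sum_def]

theorem toeplitzForm_add_left (C : ℤ → R) (f₁ f₂ g : R[X]) :
    toeplitzForm C (f₁ + f₂) g = toeplitzForm C f₁ g + toeplitzForm C f₂ g := by
  rw [toeplitzForm, sum_add_index]
  · rfl
  · simp [Polynomial.sum_def]
  · intro k a b
    simp [Polynomial.sum_def, add_mul, Finset.sum_add_distrib]

theorem toeplitzForm_C_mul_left (C : ℤ → R) (a : R) (f g : R[X]) :
    toeplitzForm C (Polynomial.C a * f) g = a * toeplitzForm C f g := by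
  have hN : (Polynomial.C a * f).natDegree < f.natDegree + g.natDegree + 1 :=
    (natDegree_C_mul_le a f).trans_lt (by omega)
  rw [toeplitzForm_eq_sum_range C hN (by omega),
    toeplitzForm_eq_sum_range C (N := f.natDegree + g.natDegree + 1) (by omega) (by omega)]
  simp [Finset.mul_sum, mul_assoc]

theorem toeplitzForm_zero_left (C : ℤ → R) (g : R[X]) : toeplitzForm C 0 g = 0 := by
  simp [toeplitzForm]

theorem toeplitzForm_sub_left (C : ℤ → R) (f₁ f₂ g : R[X]) :
    toeplitzForm C (f₁ - f₂) g = toeplitzForm C f₁ g - toeplitzForm C f₂ g := by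
  rw [eq_sub_iff_add_eq, ← toeplitzForm_add_left, sub_add_cancel]

theorem toeplitzForm_sum_left {ι : Type*} (C : ℤ → R) (s : Finset ι) (f : ι → R[X]) (g : R[X]) :
    toeplitzForm C (∑ i ∈ s, f i) g = ∑ i ∈ s, toeplitzForm C (f i) g := by
  classical
  induction s using Finset.induction_on with
  | empty => simp [toeplitzForm_zero_left]
  | insert i s hi ih => rw [Finset.sum_insert hi, Finset.sum_insert hi, toeplitzForm_add_left, ih]

theorem star_toeplitzForm {C : ℤ → R} (hC : ∀ n, star (C n) = C (-n)) (f g : R[X]) :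
    star (toeplitzForm C f g) = toeplitzForm C g f := by
  have hf : f.natDegree < f.natDegree + g.natDegree + 1 := by omega
  have hg : g.natDegree < f.natDegree + g.natDegree + 1 := by omega
  rw [toeplitzForm_eq_sum_range C hf hg, toeplitzForm_eq_sum_range C hg hf, Finset.sum_comm]
  simp [star_sum, hC, mul_assoc]

theorem toeplitzForm_C_mul_right {C : ℤ → R} (hC : ∀ n, star (C n) = C (-n)) (a : R) (f g : R[X]) :
    toeplitzForm C f (Polynomial.C a * g) = toeplitzForm C f g * star a := by
  rw [← star_toeplitzForm hC, toeplitzForm_C_mul_left, star_mul, star_toeplitzForm hC]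

theorem toeplitzForm_map {S : Type*} [Ring S] [StarRing S] (χ : R →+* S)
    (hχ : ∀ a, χ (star a) = star (χ a)) (C : ℤ → R) (f g : R[X]) :
    toeplitzForm (fun n => χ (C n)) (f.map χ) (g.map χ) = χ (toeplitzForm C f g) := by
  have hf : f.natDegree < f.natDegree + g.natDegree + 1 := by omega
  have hg : g.natDegree < f.natDegree + g.natDegree + 1 := by omega
  rw [toeplitzForm_eq_sum_range C hf hg, toeplitzForm_eq_sum_range _
    (natDegree_map_le.trans_lt hf) (natDegree_map_le.trans_lt hg)]
  simp [map_sum, hχ]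

theorem coeffStar_map {S : Type*} [Ring S] [StarRing S] (χ : R →+* S)
    (hχ : ∀ a, χ (star a) = star (χ a)) (f : R[X]) :
    coeffStar (f.map χ) = (coeffStar f).map χ := by
  ext n
  simp [coeff_coeffStar, hχ]

omit [StarRing R] in
/-- If `φ_k` has degree at most `k` and an invertible coefficient at `z ^ k`, then the `φ_k` with
`k < n` generate the left module of polynomials of degree less than `n`. -/
theorem exists_eq_sum_C_mul {φ : ℕ → R[X]} (hdeg : ∀ n, (φ n).natDegree ≤ n)
    (hunit : ∀ n, IsUnit ((φ n).coeff n)) (n : ℕ) (f : R[X]) (hf : ∀ m, n ≤ m → f.coeff m = 0) :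
    ∃ b : ℕ → R, f = ∑ k ∈ Finset.range n, C (b k) * φ k := by
  induction n generalizing f with
  | zero => exact ⟨0, by ext m; simp [hf m (Nat.zero_le m)]⟩
  | succ n ih =>
    obtain ⟨u, hu⟩ := hunit n
    obtain ⟨b, hb⟩ := ih (f - C (f.coeff n * (↑u⁻¹ : R)) * φ n) (by
      intro m hm
      rcases hm.eq_or_lt with rfl | hm
      · rw [coeff_sub, coeff_C_mul, ← hu, mul_assoc, Units.inv_mul, mul_one, sub_self]
      · rw [coeff_sub, coeff_C_mul, hf m hm,
          coeff_eq_zero_of_natDegree_lt ((hdeg n).trans_lt hm), mul_zero, sub_zero])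
    refine ⟨Function.update b n (f.coeff n * (↑u⁻¹ : R)), ?_⟩
    rw [Finset.sum_range_succ, Function.update_self, ← sub_eq_iff_eq_add, hb]
    refine Finset.sum_congr rfl fun k hk => ?_
    rw [Function.update_of_ne (Finset.mem_range.1 hk).ne]

/-- A polynomial of degree less than `n` which is orthogonal to the first `n` members of an
orthonormal sequence vanishes. -/
theorem eq_zero_of_forall_toeplitzForm_eq_zero (c : ℤ → R) {φ : ℕ → R[X]}
    (hdeg : ∀ n, (φ n).natDegree ≤ n) (hunit : ∀ n, IsUnit ((φ n).coeff n))
    (horth : ∀ n m, toeplitzForm c (φ n) (φ m) = if n = m then 1 else 0) {n : ℕ} {f : R[X]}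
    (hf : ∀ m, n ≤ m → f.coeff m = 0) (h : ∀ k < n, toeplitzForm c f (φ k) = 0) : f = 0 := by
  obtain ⟨b, rfl⟩ := exists_eq_sum_C_mul hdeg hunit n f hf
  refine Finset.sum_eq_zero fun k hk => ?_
  have hb := h k (Finset.mem_range.1 hk)
  simp only [toeplitzForm_sum_left, toeplitzForm_C_mul_left, horth, mul_ite, mul_one, mul_zero,
    Finset.sum_ite_eq', hk, if_true] at hb
  rw [hb, C_0, zero_mul]

end ToeplitzForm

/-! ### Uniqueness of orthonormal matrix polynomials -/

section Uniqueness

open scoped MatrixOrder Matrix.Norms.L2Operator in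
/-- Uniqueness of the polar decomposition, for a positive definite matrix. -/
theorem eq_one_of_unitary_mul_posDef {n : Type*} [Fintype n] [DecidableEq n]
    {A P Q : Matrix n n ℂ} (hA : A * Aᴴ = 1) (hP : P.PosDef) (hQ : Q.PosDef) (h : P = A * Q) :
    A = 1 := by
  -- `P` and `Q` are positive square roots of the same matrix
  have hsq : P ^ 2 = Q ^ 2 := by
    calc P ^ 2 = Pᴴ * P := by rw [hP.isHermitian.eq, sq]
      _ = Qᴴ * (Aᴴ * A) * Q := by rw [h, Matrix.conjTranspose_mul]; simp only [mul_assoc]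
      _ = Q ^ 2 := by rw [mul_eq_one_comm.1 hA, hQ.isHermitian.eq, mul_one, sq]
  have hPQ : P = Q :=
    (CFC.sq_eq_sq_iff P Q hP.posSemidef.nonneg hQ.posSemidef.nonneg).1 hsq
  obtain ⟨u, hu⟩ := hQ.isUnit
  rw [hPQ, ← hu] at h
  exact (Units.eq_mul_inv_iff_mul_eq u).2 h.symm |>.trans (Units.mul_inv u)

/-- The normalised orthonormal sequences of matrix polynomials for the form
`∑ f_k C_{k-l} (g_l)*` of a sequence `C` of `2 × 2` matrices. -/
structure IsToeplitzOrthonormal (C : ℤ → Matrix (Fin 2) (Fin 2) ℂ) (φ : ℕ → MatPoly) : Prop where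
  natDegree_le : ∀ n, (φ n).natDegree ≤ n
  orthonormal : ∀ n m, toeplitzForm C (φ n) (φ m) = if n = m then 1 else 0
  posDef_zero : ((φ 0).coeff 0).PosDef
  posDef_succ : ∀ n, ((φ (n + 1)).coeff (n + 1) * ((φ n).coeff n)⁻¹).PosDef

theorem IsToeplitzOrthonormal.isUnit_coeff {C : ℤ → Matrix (Fin 2) (Fin 2) ℂ} {φ : ℕ → MatPoly}
    (hφ : IsToeplitzOrthonormal C φ) (n : ℕ) : IsUnit ((φ n).coeff n) := by
  cases n with
  | zero => exact hφ.posDef_zero.isUnit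
  | succ n =>
    have h := (hφ.posDef_succ n).isUnit
    rw [Matrix.isUnit_iff_isUnit_det, Matrix.det_mul] at h
    exact (Matrix.isUnit_iff_isUnit_det _).2 (isUnit_of_mul_isUnit_left h)

/-- No definiteness of the form is needed here: orthonormality supplies what is used. -/
theorem IsToeplitzOrthonormal.unique {C : ℤ → Matrix (Fin 2) (Fin 2) ℂ}
    (hC : ∀ n, star (C n) = C (-n)) {φ ψ : ℕ → MatPoly}
    (hφ : IsToeplitzOrthonormal C φ) (hψ : IsToeplitzOrthonormal C ψ) : φ = ψ := by
  funext n
  induction n using Nat.strong_induction_on with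
  | _ n ih =>
    obtain ⟨u, hu⟩ := hψ.isUnit_coeff n
    set A := (φ n).coeff n * (↑u⁻¹ : Matrix (Fin 2) (Fin 2) ℂ) with hA
    have hAψ : (φ n).coeff n = A * (ψ n).coeff n := by
      rw [hA, ← hu, mul_assoc, Units.inv_mul, mul_one]
    -- the leading coefficients cancel in `φ n - A ψ n`, which is orthogonal to `ψ k` for `k < n`
    have hsub : φ n - Polynomial.C A * ψ n = 0 := by
      refine eq_zero_of_forall_toeplitzForm_eq_zero C hψ.natDegree_le hψ.isUnit_coeff
        hψ.orthonormal (n := n) ?_ ?_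
      · intro m hm
        rcases hm.eq_or_lt with rfl | hm
        · rw [coeff_sub, coeff_C_mul, hAψ, sub_self]
        · rw [coeff_sub, coeff_C_mul,
            coeff_eq_zero_of_natDegree_lt ((hψ.natDegree_le n).trans_lt hm),
            coeff_eq_zero_of_natDegree_lt ((hφ.natDegree_le n).trans_lt hm), mul_zero, sub_zero]
      · intro k hk
        rw [toeplitzForm_sub_left, toeplitzForm_C_mul_left, hψ.orthonormal, ← ih k hk,
          hφ.orthonormal, if_neg hk.ne', mul_zero, sub_zero]
    have hφψ : φ n = Polynomial.C A * ψ n := sub_eq_zero.1 hsub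
    have hunit : A * Aᴴ = 1 := by
      have h := hφ.orthonormal n n
      rwa [hφψ, toeplitzForm_C_mul_left, toeplitzForm_C_mul_right hC, hψ.orthonormal, if_pos rfl,
        one_mul] at h
    have hone : A = 1 := by
      cases n with
      | zero => exact eq_one_of_unitary_mul_posDef hunit hφ.posDef_zero hψ.posDef_zero hAψ
      | succ n =>
        refine eq_one_of_unitary_mul_posDef hunit (hφ.posDef_succ n) (hψ.posDef_succ n) ?_
        rw [hAψ, ih n n.lt_succ_self, mul_assoc]
    rw [hφψ, hone, C_1, one_mul]

end Uniqueness

/-! ### Integration against matrix measures -/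

section Measure

/-- A complex measure has finite variation, since its real and imaginary parts do. This makes
continuous functions integrable. -/
instance isFiniteMeasure_variation (ν : ComplexMeasure Circle) :
    IsFiniteMeasure ν.variation := by
  refine isFiniteMeasure_of_le ((ComplexMeasure.re ν).totalVariation +
    (ComplexMeasure.im ν).totalVariation) ?_
  refine VectorMeasure.variation_le_of_forall_enorm_le fun s hs => ?_
  rw [Measure.add_apply]
  refine le_trans ?_ (add_le_add ((ComplexMeasure.re ν).enorm_le_totalVariation s)
    ((ComplexMeasure.im ν).enorm_le_totalVariation s))
  rw [← ofReal_norm, ← ofReal_norm, ← ofReal_norm,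
    ← ENNReal.ofReal_add (norm_nonneg _) (norm_nonneg _)]
  exact ENNReal.ofReal_le_ofReal (Complex.norm_le_abs_re_add_abs_im (ν s))

theorem integrable_variation_of_continuous (ν : ComplexMeasure Circle) {f : Circle → ℂ}
    (hf : Continuous f) : Integrable f ν.variation :=
  hf.integrable_of_hasCompactSupport (HasCompactSupport.of_compactSpace f)

theorem cIntegral_sum (ν : ComplexMeasure Circle) {ι : Type*} (s : Finset ι)
    {f : ι → Circle → ℂ} (hf : ∀ k ∈ s, Continuous (f k)) :
    cIntegral ν (fun z => ∑ k ∈ s, f k z) = ∑ k ∈ s, cIntegral ν (f k) :=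
  VectorMeasure.integral_finsetSum s
    fun k hk => integrable_variation_of_continuous ν (hf k hk)

theorem cIntegral_const_mul (ν : ComplexMeasure Circle) (a : ℂ) (f : Circle → ℂ) :
    cIntegral ν (fun z => a * f z) = a * cIntegral ν f :=
  setToFun_smul _ (fun c s x => by
    change (c * x) * ν s = c * (x * ν s)
    rw [mul_assoc]) a f

/-- Conjugation of the integral: both sides are integrals of `f` for the pairing
`(x, y) ↦ conj (x y)`, against measures of the same variation. -/
theorem star_cIntegral {ν ν' : ComplexMeasure Circle}
    (h : ∀ s, MeasurableSet s → ν' s = star (ν s)) {f : Circle → ℂ} (hf : Continuous f) :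
    star (cIntegral ν f) = cIntegral ν' fun z => star (f z) := by
  have hvar : ν'.variation = ν.variation := by
    refine le_antisymm (VectorMeasure.variation_le_of_forall_enorm_le fun s hs => ?_)
      (VectorMeasure.variation_le_of_forall_enorm_le fun s hs => ?_)
    · rw [h s hs]
      refine le_trans (le_of_eq ?_) (ν.enorm_measure_le_variation s)
      rw [← ofReal_norm, norm_star, ofReal_norm]
    · refine le_trans (le_of_eq ?_) (ν'.enorm_measure_le_variation s)
      rw [h s hs, ← ofReal_norm, ← ofReal_norm, norm_star]
  have hf' := integrable_variation_of_continuous ν hf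
  have hf'' := integrable_variation_of_continuous ν' hf
  have e1 : star (cIntegral ν f) = _ :=
    VectorMeasure.continuousLinearMap_apply_integral (C := (Complex.conjCLE : ℂ →L[ℝ] ℂ)) hf'
  have e2 : (cIntegral ν' fun z => star (f z)) = _ :=
    VectorMeasure.integral_continuousLinearMap_comp (C := (Complex.conjCLE : ℂ →L[ℝ] ℂ)) hf''
  rw [e1, e2]
  have hT := dominatedFinMeasAdditive_cbmApplyMeasure ν'
    (ContinuousLinearMap.mul ℝ ℂ ∘L (Complex.conjCLE : ℂ →L[ℝ] ℂ))
  rw [hvar] at hT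
  refine (setToFun_congr_left' _ hT (fun s hs _ => ?_) f).trans
    (setToFun_congr_measure 1 1 ENNReal.one_ne_top ENNReal.one_ne_top ?_ ?_ _ _ f)
  · refine ContinuousLinearMap.ext fun x => ?_
    change star (x * ν s) = star x * ν' s
    rw [h s hs, star_mul']
  · rw [hvar, one_smul]
  · rw [hvar, one_smul]

theorem continuous_zpow_coe (n : ℤ) : Continuous fun z : Circle => (z : ℂ) ^ n :=
  Continuous.zpow₀ (by fun_prop) n fun z => Or.inl z.coe_ne_zero

theorem cIntegral_trigonometric (ν : ComplexMeasure Circle) (p q : ℕ → ℂ) (N : ℕ) :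
    cIntegral ν (fun z => (∑ m ∈ Finset.range N, p m * (z : ℂ) ^ m) *
      ∑ n ∈ Finset.range N, q n * star (z : ℂ) ^ n) =
    ∑ m ∈ Finset.range N, ∑ n ∈ Finset.range N,
      p m * q n * cIntegral ν fun z => (z : ℂ) ^ ((m : ℤ) - (n : ℤ)) := by
  have h : (fun z : Circle => (∑ m ∈ Finset.range N, p m * (z : ℂ) ^ m) *
      ∑ n ∈ Finset.range N, q n * star (z : ℂ) ^ n) = fun z : Circle => ∑ m ∈ Finset.range N,
      ∑ n ∈ Finset.range N, p m * q n * (z : ℂ) ^ ((m : ℤ) - (n : ℤ)) := by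
    funext z
    rw [Finset.sum_mul_sum]
    refine Finset.sum_congr rfl fun m _ => Finset.sum_congr rfl fun n _ => ?_
    have hz : star (z : ℂ) = (z : ℂ)⁻¹ := (Circle.coe_inv_eq_conj z).symm.trans (Circle.coe_inv z)
    rw [zpow_sub₀ z.coe_ne_zero, zpow_natCast, zpow_natCast, hz, inv_pow]
    ring
  rw [h, cIntegral_sum]
  · refine Finset.sum_congr rfl fun m _ => ?_
    rw [cIntegral_sum]
    · exact Finset.sum_congr rfl fun n _ => cIntegral_const_mul _ _ _
    · exact fun n _ => continuous_const.mul (continuous_zpow_coe _)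
  · exact fun m _ => continuous_finsetSum _ fun n _ =>
      continuous_const.mul (continuous_zpow_coe _)

theorem moment_apply (M : MatMeasure) (n : ℤ) (a b : Fin 2) :
    moment M n a b = cIntegral (M.entry a b) fun z => (z : ℂ) ^ n := by
  have h0 : ∀ ν : ComplexMeasure Circle, cIntegral ν (fun _ => 0) = 0 := fun ν =>
    VectorMeasure.integral_zero
  fin_cases a <;> fin_cases b <;> simp [moment, matIntegral, h0]

/-- Positivity enters only through the measure being Hermitian-valued. -/
theorem star_moment {M : MatMeasure} (hM : IsPositive M) (n : ℤ) :
    star (moment M n) = moment M (-n) := by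
  ext a b
  rw [Matrix.star_apply, moment_apply, moment_apply,
    star_cIntegral (ν' := M.entry a b) ?_ (continuous_zpow_coe n)]
  · congr 1
    funext z
    have hz : star (z : ℂ) = (z : ℂ)⁻¹ := (Circle.coe_inv_eq_conj z).symm.trans (Circle.coe_inv z)
    rw [star_zpow₀, hz, inv_zpow, zpow_neg]
  · intro s hs
    exact ((hM s hs).isHermitian.apply a b).symm

theorem matEval_apply {f : MatPoly} {N : ℕ} (hf : f.natDegree < N) (z : Circle) (a b : Fin 2) :
    matEval f z a b = ∑ m ∈ Finset.range N, f.coeff m a b * (z : ℂ) ^ m := by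
  rw [matEval, sum_over_range' _ (by simp) N hf, Matrix.sum_apply]
  exact Finset.sum_congr rfl fun m _ => by simp [mul_comm]

theorem conjTranspose_matEval_apply {f : MatPoly} {N : ℕ} (hf : f.natDegree < N) (z : Circle)
    (a b : Fin 2) :
    (matEval f z)ᴴ a b = ∑ m ∈ Finset.range N, star (f.coeff m b a) * star (z : ℂ) ^ m := by
  rw [Matrix.conjTranspose_apply, matEval_apply hf, star_sum]
  exact Finset.sum_congr rfl fun m _ => by rw [star_mul', star_pow]

theorem matInnerL_eq_toeplitzForm (M : MatMeasure) (f g : MatPoly) :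
    matInnerL M f g = toeplitzForm (moment M) f g := by
  have hf : f.natDegree < f.natDegree + g.natDegree + 1 := by omega
  have hg : g.natDegree < f.natDegree + g.natDegree + 1 := by omega
  rw [toeplitzForm_eq_sum_range _ hf hg]
  ext a b
  simp only [matInnerL, matIntegral, Matrix.of_apply, matEval_apply hf,
    conjTranspose_matEval_apply hg, cIntegral_trigonometric, Fin.sum_univ_two, Matrix.sum_apply,
    Matrix.mul_apply, Matrix.star_apply, moment_apply, ← Finset.sum_add_distrib]
  exact Finset.sum_congr rfl fun m _ => Finset.sum_congr rfl fun n _ => by ring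

/-- Taking adjoints of coefficients turns the right inner product into a left one, for the
reflected sequence of moments. -/
theorem matInnerR_eq_toeplitzForm (M : MatMeasure) (f g : MatPoly) :
    matInnerR M f g = toeplitzForm (fun n => moment M (-n)) (coeffStar g) (coeffStar f) := by
  have hf : f.natDegree < f.natDegree + g.natDegree + 1 := by omega
  have hg : g.natDegree < f.natDegree + g.natDegree + 1 := by omega
  rw [toeplitzForm_eq_sum_range _ ((natDegree_coeffStar_le le_rfl).trans_lt hg)
    ((natDegree_coeffStar_le le_rfl).trans_lt hf), Finset.sum_comm]
  ext a b
  simp only [matInnerR, matIntegral, Matrix.of_apply, matEval_apply hf,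
    conjTranspose_matEval_apply hg, mul_comm (∑ n ∈ _, star _ * _), cIntegral_trigonometric,
    Fin.sum_univ_two, Matrix.sum_apply, coeff_coeffStar, star_star, neg_sub,
    Matrix.mul_apply, Matrix.star_apply, moment_apply, ← Finset.sum_add_distrib]
  exact Finset.sum_congr rfl fun m _ => Finset.sum_congr rfl fun n _ => by ring

end Measure

/-! ### Multiplicativity of `χ_i` -/

section Chi

theorem comp₁_slice_add {i j : ℍ[ℝ]} (hi : i ∈ imagUnits) (hj : j ∈ imagUnits)
    (hij : inner ℝ i j = 0) (x y : ℂ) : comp₁ i (slice i x + slice i y * j) = x := by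
  obtain ⟨hi0, hi1⟩ := hi
  obtain ⟨hj0, -⟩ := hj
  have hi2 : inner ℝ i i = 1 := by rw [real_inner_self_eq_norm_sq, hi1, one_pow]
  simp only [Quaternion.inner_def, Quaternion.re_mul, Quaternion.re_star, Quaternion.imI_star,
    Quaternion.imJ_star, Quaternion.imK_star, hi0, hj0] at hi2 hij
  apply Complex.ext <;> simp [comp₁, slice, Quaternion.inner_def, hi0, hj0]
  · linear_combination -y.im * hij
  · linear_combination x.im * hi2 + y.re * hij

theorem comp₂_slice_add {i j : ℍ[ℝ]} (hi : i ∈ imagUnits) (hj : j ∈ imagUnits)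
    (hij : inner ℝ i j = 0) (x y : ℂ) : comp₂ i j (slice i x + slice i y * j) = y := by
  obtain ⟨hi0, hi1⟩ := hi
  obtain ⟨hj0, hj1⟩ := hj
  have hi2 : inner ℝ i i = 1 := by rw [real_inner_self_eq_norm_sq, hi1, one_pow]
  have hj2 : inner ℝ j j = 1 := by rw [real_inner_self_eq_norm_sq, hj1, one_pow]
  simp only [Quaternion.inner_def, Quaternion.re_mul, Quaternion.re_star, Quaternion.imI_star,
    Quaternion.imJ_star, Quaternion.imK_star, hi0, hj0] at hi2 hj2 hij
  apply Complex.ext <;> simp [comp₂, slice, Quaternion.inner_def, hi0, hj0]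
  · linear_combination x.im * hij + y.re * hj2
  · linear_combination (-x.re) * hij + y.im *
      ((j.imI ^ 2 + j.imJ ^ 2 + j.imK ^ 2) * hi2 + hj2)

theorem mul_self_of_mem_imagUnits {i : ℍ[ℝ]} (hi : i ∈ imagUnits) : i * i = -1 := by
  obtain ⟨hi0, hi1⟩ := hi
  have hi2 : inner ℝ i i = 1 := by rw [real_inner_self_eq_norm_sq, hi1, one_pow]
  simp only [Quaternion.inner_def, Quaternion.re_mul, Quaternion.re_star, Quaternion.imI_star,
    Quaternion.imJ_star, Quaternion.imK_star, hi0] at hi2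
  ext <;> simp [hi0] <;> linarith

theorem mul_comm_of_orthogonal {i j : ℍ[ℝ]} (hi : i ∈ imagUnits) (hj : j ∈ imagUnits)
    (hij : inner ℝ i j = 0) : j * i = -(i * j) := by
  obtain ⟨hi0, -⟩ := hi
  obtain ⟨hj0, -⟩ := hj
  simp only [Quaternion.inner_def, Quaternion.re_mul, Quaternion.re_star, Quaternion.imI_star,
    Quaternion.imJ_star, Quaternion.imK_star, hi0, hj0] at hij
  ext <;> simp [hi0, hj0] <;> linarith

theorem slice_mul {i : ℍ[ℝ]} (hi : i ∈ imagUnits) (x y : ℂ) :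
    slice i (x * y) = slice i x * slice i y := by
  have h := mul_self_of_mem_imagUnits hi
  have hc : ∀ r : ℝ, i * (r : ℍ[ℝ]) = r * i := fun r => (Quaternion.coe_commutes r i).symm
  simp only [slice, Complex.mul_re, Complex.mul_im, Quaternion.coe_sub, Quaternion.coe_add,
    Quaternion.coe_mul, add_mul, mul_add]
  have e1 : (x.im : ℍ[ℝ]) * i * (y.re : ℍ[ℝ]) = x.im * y.re * i := by rw [mul_assoc, hc, mul_assoc]
  have e2 : (x.im : ℍ[ℝ]) * i * ((y.im : ℍ[ℝ]) * i) = -(x.im * y.im) := by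
    rw [mul_assoc, ← mul_assoc i, hc, mul_assoc, h, ← mul_assoc]; simp
  rw [e1, e2, ← mul_assoc]
  abel

theorem slice_add (i : ℍ[ℝ]) (x y : ℂ) : slice i (x + y) = slice i x + slice i y := by
  simp only [slice, Complex.add_re, Complex.add_im, Quaternion.coe_add, add_mul]
  abel

/-- The relation `j x = x̄ j` for `x ∈ ℂ_i`. -/
theorem mul_slice {i j : ℍ[ℝ]} (hi : i ∈ imagUnits) (hj : j ∈ imagUnits)
    (hij : inner ℝ i j = 0) (x : ℂ) : j * slice i x = slice i (star x) * j := by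
  have hc : ∀ r : ℝ, j * (r : ℍ[ℝ]) = r * j := fun r => (Quaternion.coe_commutes r j).symm
  have h := mul_comm_of_orthogonal hi hj hij
  simp only [slice, mul_add, add_mul, hc, ← mul_assoc]
  rw [mul_assoc (x.im : ℍ[ℝ]), h]
  simp [mul_assoc]

/-- The components of a product, from `j x = x̄ j` for `x ∈ ℂ_i`. -/
theorem comp_mul {i j : ℍ[ℝ]} (hi : i ∈ imagUnits) (hj : j ∈ imagUnits)
    (hij : inner ℝ i j = 0) (p q : ℍ[ℝ]) :
    comp₁ i (p * q) = comp₁ i p * comp₁ i q - comp₂ i j p * star (comp₂ i j q) ∧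
    comp₂ i j (p * q) = comp₁ i p * comp₂ i j q + comp₂ i j p * star (comp₁ i q) := by
  have key : p * q =
      slice i (comp₁ i p * comp₁ i q - comp₂ i j p * star (comp₂ i j q)) +
      slice i (comp₁ i p * comp₂ i j q + comp₂ i j p * star (comp₁ i q)) * j := by
    have hneg : ∀ x, slice i (-x) = -slice i x := fun x => by
      rw [eq_neg_iff_add_eq_zero, ← slice_add]; simp [slice]
    conv_lhs => rw [← slice_comp hi hj hij p, ← slice_comp hi hj hij q]
    generalize comp₁ i p = a
    generalize comp₁ i q = b
    generalize comp₂ i j p = d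
    generalize comp₂ i j q = e
    have e1 : slice i d * j * slice i b = slice i d * slice i (star b) * j := by
      rw [mul_assoc, mul_slice hi hj hij, mul_assoc]
    have e2 : slice i d * j * (slice i e * j) = -(slice i d * slice i (star e)) := by
      rw [mul_assoc, ← mul_assoc j, mul_slice hi hj hij, mul_assoc, mul_self_of_mem_imagUnits hj,
        mul_neg_one, mul_neg]
    rw [sub_eq_add_neg, slice_add, hneg, slice_add, slice_mul hi, slice_mul hi, slice_mul hi,
      slice_mul hi, add_mul, add_mul, mul_add, mul_add, e1, e2]
    simp only [mul_assoc]
    abel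
  constructor
  · rw [key, comp₁_slice_add hi hj hij]
  · rw [key, comp₂_slice_add hi hj hij]

/-- The embedding `χ_i` as a ring homomorphism. -/
def chiHom {i j : ℍ[ℝ]} (hi : i ∈ imagUnits) (hj : j ∈ imagUnits) (hij : inner ℝ i j = 0) :
    ℍ[ℝ] →+* Matrix (Fin 2) (Fin 2) ℂ where
  toFun := chi i j
  map_zero' := chi_zero i j
  map_add' p q := by
    have h1 : comp₁ i (p + q) = comp₁ i p + comp₁ i q := by
      apply Complex.ext <;> simp [comp₁, inner_add_left]
    have h2 : comp₂ i j (p + q) = comp₂ i j p + comp₂ i j q := by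
      apply Complex.ext <;> simp [comp₂, inner_add_left]
    ext a b
    fin_cases a <;> fin_cases b <;> simp [chi, h1, h2, add_comm]
  map_one' := by
    have h := comp₁_slice_add hi hj hij 1 0
    have h' := comp₂_slice_add hi hj hij 1 0
    simp [slice] at h h'
    ext a b
    fin_cases a <;> fin_cases b <;> simp [chi, h, h']
  map_mul' p q := by
    obtain ⟨h1, h2⟩ := comp_mul hi hj hij p q
    ext a b
    fin_cases a <;> fin_cases b <;> simp [chi, h1, h2, Matrix.mul_apply] <;> ring

@[simp]
theorem chiHom_apply {i j : ℍ[ℝ]} (hi : i ∈ imagUnits) (hj : j ∈ imagUnits)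
    (hij : inner ℝ i j = 0) (p : ℍ[ℝ]) : chiHom hi hj hij p = chi i j p := rfl

theorem chi_star {i j : ℍ[ℝ]} (hi : i ∈ imagUnits) (hj : j ∈ imagUnits)
    (hij : inner ℝ i j = 0) (p : ℍ[ℝ]) : chi i j (star p) = star (chi i j p) := by
  have hr : (i * j).re = 0 := by
    obtain ⟨hi0, -⟩ := hi
    obtain ⟨hj0, -⟩ := hj
    simp only [Quaternion.inner_def, Quaternion.re_mul, Quaternion.re_star, Quaternion.imI_star,
      Quaternion.imJ_star, Quaternion.imK_star, hi0, hj0] at hij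
    simp only [Quaternion.re_mul, hi0, hj0]
    linarith
  have hs : ∀ q : ℍ[ℝ], q.re = 0 → inner ℝ (star p) q = -inner ℝ p q := by
    intro q hq
    simp [Quaternion.inner_def, hq]
    ring
  have h1 : comp₁ i (star p) = star (comp₁ i p) := by
    apply Complex.ext <;> simp [comp₁, hs i hi.1]
  have h2 : comp₂ i j (star p) = -comp₂ i j p := by
    apply Complex.ext <;> simp [comp₂, hs j hj.1, hs _ hr]
  ext a b
  fin_cases a <;> fin_cases b <;> simp [chi, h1, h2, Matrix.star_apply]

theorem chi_coe {i j : ℍ[ℝ]} (hi : i ∈ imagUnits) (hj : j ∈ imagUnits)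
    (hij : inner ℝ i j = 0) (r : ℝ) : chi i j (r : ℍ[ℝ]) = (r : ℂ) • 1 := by
  have h := comp₁_slice_add hi hj hij r 0
  have h' := comp₂_slice_add hi hj hij r 0
  simp [slice] at h h'
  ext a b
  fin_cases a <;> fin_cases b <;> simp [chi, h, h']

theorem PhiL_eq_map {i j : ℍ[ℝ]} (hi : i ∈ imagUnits) (hj : j ∈ imagUnits)
    (hij : inner ℝ i j = 0) (f : PolyL) : PhiL i j f = f.map (chiHom hi hj hij) := by
  ext1 n
  rw [PhiL, Polynomial.sum_def, finsetSum_coeff, coeff_map]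
  simp only [coeff_monomial]
  rw [Finset.sum_ite_eq' f.support n]
  split_ifs with h
  · rfl
  · rw [notMem_support_iff.1 h, map_zero]

theorem PhiR_eq_map {i j : ℍ[ℝ]} (hi : i ∈ imagUnits) (hj : j ∈ imagUnits)
    (hij : inner ℝ i j = 0) (f : PolyR) : PhiR i j f = f.map (chiHom hi hj hij) :=
  PhiL_eq_map hi hj hij f

end Chi

/-! ### Quaternionic orthonormal polynomials -/

section Gram

theorem qInnerL_eq_toeplitzForm (c : ℤ → ℍ[ℝ]) (f g : PolyR) :
    qInnerL c f g = toeplitzForm c f g := rfl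

theorem qInnerR_eq_toeplitzForm (c : ℤ → ℍ[ℝ]) (f g : PolyL) :
    qInnerR c f g = toeplitzForm (fun n => c (-n)) (coeffStar g) (coeffStar f) := by
  have hf : f.natDegree < f.natDegree + g.natDegree + 1 := by omega
  have hg : g.natDegree < f.natDegree + g.natDegree + 1 := by omega
  rw [toeplitzForm_eq_sum_range _ ((natDegree_coeffStar_le le_rfl).trans_lt hg)
    ((natDegree_coeffStar_le le_rfl).trans_lt hf), qInnerR, sum_over_range' _ _ _ hg]
  · refine Finset.sum_congr rfl fun l _ => ?_
    rw [sum_over_range' _ (by simp) _ hf]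
    simp [coeff_coeffStar]
  · simp [Polynomial.sum_def]

theorem real_smul_eq_C_mul (r : ℝ) (f : ℍ[ℝ][X]) : r • f = C (r : ℍ[ℝ]) * f := by
  ext1 n
  rw [coeff_smul, coeff_C_mul, Quaternion.coe_mul_eq_smul]

/-- Adjoints of coefficients exchange the left and the right Gram-Schmidt processes. -/
theorem coeffStar_psiR {c : ℤ → ℍ[ℝ]} (hc : ∀ n, star (c n) = c (-n)) (n : ℕ) :
    coeffStar (psiR c n) = psiL (fun n => c (-n)) n := by
  have hc' : ∀ n, star (c (-n)) = c (- -n) := fun n => hc (-n)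
  induction n using Nat.strong_induction_on with
  | _ n ih =>
    have hX : coeffStar (X ^ n : ℍ[ℝ][X]) = X ^ n := by
      ext1 m
      rw [coeff_coeffStar, coeff_X_pow]
      split_ifs <;> simp
    set u : PolyL := X ^ n - ∑ k : Fin n, psiR c k * C (qInnerR c (X ^ n) (psiR c k)) with hu
    set v : PolyR := X ^ n - ∑ k : Fin n,
      C (qInnerL (fun n => c (-n)) (X ^ n) (psiL (fun n => c (-n)) k)) *
        psiL (fun n => c (-n)) k with hv
    have hR : psiR c n = (√(qInnerR c u u).re)⁻¹ • u := by
      rw [psiR]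
    have hL : psiL (fun n => c (-n)) n = (√(qInnerL (fun n => c (-n)) v v).re)⁻¹ • v := by
      rw [psiL]
    have huv : coeffStar u = v := by
      ext1 m
      rw [coeff_coeffStar, hu, hv, coeff_sub, coeff_sub, star_sub, ← coeff_coeffStar, hX,
        finsetSum_coeff, finsetSum_coeff, star_sum]
      congr 1
      refine Finset.sum_congr rfl fun k _ => ?_
      rw [coeff_mul_C, coeff_C_mul, star_mul, ← coeff_coeffStar, ih k k.2,
        qInnerR_eq_toeplitzForm, ih k k.2, hX, star_toeplitzForm hc', qInnerL_eq_toeplitzForm]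
    rw [hR, hL, qInnerR_eq_toeplitzForm, qInnerL_eq_toeplitzForm, huv]
    ext1 m
    rw [coeff_coeffStar, coeff_smul, coeff_smul, Quaternion.star_smul, ← coeff_coeffStar, huv]

/-- Gram-Schmidt: if the form of `c` is positive definite, then the `psiL c n` are orthonormal and
have positive real leading coefficients. -/
theorem psiL_spec {c : ℤ → ℍ[ℝ]} (hc : ∀ n, star (c n) = c (-n))
    (hpos : ∀ f : ℍ[ℝ][X], f ≠ 0 → ∃ r : ℝ, 0 < r ∧ toeplitzForm c f f = (r : ℍ[ℝ])) (n : ℕ) :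
    (psiL c n).natDegree ≤ n ∧ (∃ r : ℝ, 0 < r ∧ (psiL c n).coeff n = (r : ℍ[ℝ])) ∧
      (∀ m < n, toeplitzForm c (psiL c n) (psiL c m) = 0) ∧
      toeplitzForm c (psiL c n) (psiL c n) = 1 := by
  induction n using Nat.strong_induction_on with
  | _ n ih =>
    have horth : ∀ k < n, ∀ m < n,
        toeplitzForm c (psiL c k) (psiL c m) = if k = m then 1 else 0 := by
      intro k hk m hm
      rcases lt_trichotomy k m with h | rfl | h
      · rw [if_neg h.ne, ← star_toeplitzForm hc, (ih m hm).2.2.1 k h, star_zero]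
      · rw [if_pos rfl, (ih k hk).2.2.2]
      · rw [if_neg h.ne', (ih k hk).2.2.1 m h]
    set u : ℍ[ℝ][X] := X ^ n - ∑ k : Fin n, C (toeplitzForm c (X ^ n) (psiL c k)) * psiL c k
      with hu
    have hψ : psiL c n = (√(toeplitzForm c u u).re)⁻¹ • u := by
      rw [psiL]
      rfl
    have hcoeff : ∀ m, n ≤ m → u.coeff m = if m = n then 1 else 0 := by
      intro m hm
      rw [hu, coeff_sub, coeff_X_pow, finsetSum_coeff, Finset.sum_eq_zero, sub_zero]
      intro k _
      rw [coeff_C_mul, coeff_eq_zero_of_natDegree_lt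
        (((ih k k.2).1.trans_lt k.2).trans_le hm), mul_zero]
    have hu0 : u ≠ 0 := fun h => by simpa [h] using hcoeff n le_rfl
    obtain ⟨r, hr, hur⟩ := hpos u hu0
    have hs : 0 < √r := Real.sqrt_pos.2 hr
    rw [hur, Quaternion.re_coe] at hψ
    have huψ : ∀ m < n, toeplitzForm c u (psiL c m) = 0 := by
      intro m hm
      have hsum : ∑ k : Fin n, toeplitzForm c (X ^ n) (psiL c k) *
          toeplitzForm c (psiL c k) (psiL c m) = toeplitzForm c (X ^ n) (psiL c m) := by
        rw [Finset.sum_eq_single (⟨m, hm⟩ : Fin n)]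
        · rw [horth m hm m hm, if_pos rfl, mul_one]
        · intro k _ hk
          rw [horth k k.2 m hm, if_neg fun h => hk (Fin.ext h), mul_zero]
        · simp
      rw [hu, toeplitzForm_sub_left, toeplitzForm_sum_left]
      simp only [toeplitzForm_C_mul_left]
      rw [hsum, sub_self]
    refine ⟨?_, ⟨(√r)⁻¹, inv_pos.2 hs, ?_⟩, ?_, ?_⟩
    · rw [hψ]
      refine (natDegree_smul_le _ _).trans (natDegree_le_iff_coeff_eq_zero.2 fun m hm => ?_)
      rw [hcoeff m hm.le, if_neg hm.ne']
    · rw [hψ, real_smul_eq_C_mul, coeff_C_mul, hcoeff n le_rfl, if_pos rfl, mul_one]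
    · intro m hm
      rw [hψ, real_smul_eq_C_mul, toeplitzForm_C_mul_left, huψ m hm, mul_zero]
    · rw [hψ, real_smul_eq_C_mul, toeplitzForm_C_mul_left, toeplitzForm_C_mul_right hc, hur,
        Quaternion.star_coe, ← Quaternion.coe_mul, ← Quaternion.coe_mul]
      nth_rewrite 2 [← Real.mul_self_sqrt hr.le]
      rw [mul_assoc, mul_inv_cancel₀ hs.ne', mul_one, inv_mul_cancel₀ hs.ne', Quaternion.coe_one]

end Gram

/-! ### The quaternionic structure of matrix orthonormal polynomials -/

section Correspondence

variable {i j : ℍ[ℝ]}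

theorem map_chiHom_ne_zero (hi : i ∈ imagUnits) (hj : j ∈ imagUnits) (hij : inner ℝ i j = 0)
    {f : ℍ[ℝ][X]} (hf : f ≠ 0) : f.map (chiHom hi hj hij) ≠ 0 :=
  (Polynomial.map_ne_zero_iff (chi_injective hi hj hij)).2 hf

/-- A quaternionic form with a definite image under `χ_i` is real and positive on the diagonal:
`⟨f, f⟩` is self-adjoint, hence real, and `χ_i(r) = r I` has trace `2 r`. -/
theorem toeplitzForm_self_pos (hi : i ∈ imagUnits) (hj : j ∈ imagUnits) (hij : inner ℝ i j = 0)
    {c : ℤ → ℍ[ℝ]} (hc : ∀ n, star (c n) = c (-n))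
    (hdef : ∀ f : MatPoly, √(toeplitzForm (fun n => chi i j (c n)) f f).trace.re = 0 → f = 0)
    (f : ℍ[ℝ][X]) (hf : f ≠ 0) : ∃ r : ℝ, 0 < r ∧ toeplitzForm c f f = (r : ℍ[ℝ]) := by
  have hreal : toeplitzForm c f f = ((toeplitzForm c f f).re : ℍ[ℝ]) :=
    Quaternion.star_eq_self.1 (star_toeplitzForm hc f f)
  refine ⟨_, ?_, hreal⟩
  have h := mt (hdef _) (map_chiHom_ne_zero hi hj hij hf)
  have hmap := toeplitzForm_map (chiHom hi hj hij) (chi_star hi hj hij) c f f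
  simp only [chiHom_apply] at hmap
  -- `√x = 0` for every `x ≤ 0`, so a non-zero root is enough to make the trace positive
  rw [hmap, hreal, chi_coe hi hj hij, Real.sqrt_eq_zero', not_le] at h
  simpa [Matrix.trace_smul] using h

/-- The image of the quaternionic Gram-Schmidt sequence is the normalised orthonormal sequence of
the image form: existence comes from `psiL_spec`, uniqueness from `IsToeplitzOrthonormal.unique`. -/
theorem isToeplitzOrthonormal_iff (hi : i ∈ imagUnits) (hj : j ∈ imagUnits)
    (hij : inner ℝ i j = 0) {c : ℤ → ℍ[ℝ]} (hc : ∀ n, star (c n) = c (-n))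
    (hpos : ∀ f : ℍ[ℝ][X], f ≠ 0 → ∃ r : ℝ, 0 < r ∧ toeplitzForm c f f = (r : ℍ[ℝ]))
    (φ : ℕ → MatPoly) :
    IsToeplitzOrthonormal (fun n => chi i j (c n)) φ ↔
      φ = fun n => (psiL c n).map (chiHom hi hj hij) := by
  have hspec := psiL_spec hc hpos
  have hex : IsToeplitzOrthonormal (fun n => chi i j (c n))
      fun n => (psiL c n).map (chiHom hi hj hij) := by
    have hone : (1 : Matrix (Fin 2) (Fin 2) ℂ).PosDef := Matrix.PosDef.one
    refine ⟨fun n => natDegree_map_le.trans (hspec n).1, fun n m => ?_, ?_, fun n => ?_⟩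
    · refine (toeplitzForm_map (chiHom hi hj hij) (chi_star hi hj hij) c _ _).trans ?_
      rcases lt_trichotomy n m with h | rfl | h
      · rw [if_neg h.ne, ← star_toeplitzForm hc, (hspec m).2.2.1 n h, star_zero, map_zero]
      · rw [if_pos rfl, (hspec n).2.2.2, map_one]
      · rw [if_neg h.ne', (hspec n).2.2.1 m h, map_zero]
    · obtain ⟨r, hr, hψ⟩ := (hspec 0).2.1
      rw [coeff_map, hψ, chiHom_apply, chi_coe hi hj hij]
      exact hone.smul (by exact_mod_cast hr)
    · obtain ⟨r, hr, hψ⟩ := (hspec n).2.1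
      obtain ⟨s, hs, hψ'⟩ := (hspec (n + 1)).2.1
      rw [coeff_map, coeff_map, hψ, hψ', chiHom_apply, chiHom_apply, chi_coe hi hj hij,
        chi_coe hi hj hij]
      have hinv : ((r : ℂ) • (1 : Matrix (Fin 2) (Fin 2) ℂ))⁻¹ = ((r⁻¹ : ℝ) : ℂ) • 1 := by
        refine Matrix.inv_eq_right_inv ?_
        rw [smul_mul_smul_comm, one_mul, ← Complex.ofReal_mul, mul_inv_cancel₀ hr.ne',
          Complex.ofReal_one, one_smul]
      rw [hinv, smul_mul_smul_comm, one_mul, ← Complex.ofReal_mul]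
      exact hone.smul (by exact_mod_cast mul_pos hs (inv_pos.2 hr))
  refine ⟨fun h => h.unique (fun n => ?_) hex, fun h => h ▸ hex⟩
  rw [← chi_star hi hj hij, hc]

theorem isLeftOrthonormal_iff (M : MatMeasure) (φ : ℕ → MatPoly) :
    IsLeftOrthonormal M φ ↔ IsToeplitzOrthonormal (moment M) φ := by
  constructor
  · rintro ⟨h1, h2, h3, h4⟩
    exact ⟨h1, fun n m => by rw [← matInnerL_eq_toeplitzForm, h2], h3, h4⟩
  · rintro ⟨h1, h2, h3, h4⟩
    exact ⟨h1, fun n m => by rw [matInnerL_eq_toeplitzForm, h2], h3, h4⟩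

theorem isRightOrthonormal_iff (M : MatMeasure) (φ : ℕ → MatPoly) :
    IsRightOrthonormal M φ ↔
      IsToeplitzOrthonormal (fun n => moment M (-n)) fun n => coeffStar (φ n) := by
  have hsucc : ∀ n, ((coeffStar (φ (n + 1))).coeff (n + 1) *
      ((coeffStar (φ n)).coeff n)⁻¹).PosDef ↔
      (((φ n).coeff n)⁻¹ * (φ (n + 1)).coeff (n + 1)).PosDef := fun n => by
    rw [coeff_coeffStar, coeff_coeffStar, Matrix.star_eq_conjTranspose,
      Matrix.star_eq_conjTranspose, ← Matrix.conjTranspose_nonsing_inv,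
      ← Matrix.conjTranspose_mul, Matrix.posDef_conjTranspose_iff]
  have hzero : ((coeffStar (φ 0)).coeff 0).PosDef ↔ ((φ 0).coeff 0).PosDef := by
    rw [coeff_coeffStar, Matrix.star_eq_conjTranspose, Matrix.posDef_conjTranspose_iff]
  constructor
  · rintro ⟨h1, h2, h3, h4⟩
    refine ⟨fun n => natDegree_coeffStar_le (h1 n), fun n m => ?_, hzero.2 h3,
      fun n => (hsucc n).2 (h4 n)⟩
    rw [← matInnerR_eq_toeplitzForm, h2]
    simp only [eq_comm]
  · rintro ⟨h1, h2, h3, h4⟩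
    refine ⟨fun n => ?_, fun n m => ?_, hzero.1 h3, fun n => (hsucc n).1 (h4 n)⟩
    · rw [← coeffStar_coeffStar (φ n)]
      exact natDegree_coeffStar_le (h1 n)
    · rw [matInnerR_eq_toeplitzForm, h2]
      simp only [eq_comm]

/-- The quadratic form of `T_n(c)` at `ξ` is the form of the reflected sequence at the polynomial
with coefficients `star (ξ k)`. -/
theorem isNontrivialPosDef_of_toeplitzForm_pos {c : ℤ → ℍ[ℝ]}
    (hpos : ∀ f : ℍ[ℝ][X], f ≠ 0 →
      ∃ r : ℝ, 0 < r ∧ toeplitzForm (fun n => c (-n)) f f = (r : ℍ[ℝ])) :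
    IsNontrivialPosDef c := by
  intro n ξ hξ
  set f : ℍ[ℝ][X] := ∑ k : Fin (n + 1), monomial (k : ℕ) (star (ξ k)) with hf
  have hcoeff : ∀ k : Fin (n + 1), f.coeff k = star (ξ k) := by
    intro k
    simp [hf, coeff_monomial, finsetSum_coeff, Fin.val_inj]
  have hdeg : f.natDegree < n + 1 := Nat.lt_succ_of_le
    (natDegree_sum_le_of_forall_le _ _ fun k _ =>
      (natDegree_monomial_le _).trans (Nat.le_of_lt_succ k.2))
  have hf0 : f ≠ 0 := by
    rintro h0
    refine hξ (funext fun k => ?_)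
    have h := hcoeff k
    rw [h0, coeff_zero] at h
    exact star_eq_zero.1 h.symm
  obtain ⟨r, hr, h⟩ := hpos f hf0
  refine ⟨r, hr, h ▸ ?_⟩
  rw [toeplitzForm_eq_sum_range _ hdeg hdeg, Finset.sum_range]
  simp only [Finset.sum_range, hcoeff, star_star, neg_sub, dotProduct, Matrix.mulVec, toeplitz,
    Matrix.of_apply, Pi.star_apply, Finset.mul_sum, mul_assoc]

end Correspondence

end QOPUC

end

theorem mainTheorem5 (i j : ℍ[ℝ]) (hi : i ∈ QOPUC.imagUnits) (hj : j ∈ QOPUC.imagUnits)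
    (hij : inner ℝ i j = 0) (M : QOPUC.MatMeasure) (hM : QOPUC.IsPositive M)
    (hM' : QOPUC.IsNontrivial M) (c : ℤ → ℍ[ℝ])
    (hc : ∀ n, QOPUC.chi i j (c n) = QOPUC.moment M n) :
    QOPUC.IsNontrivialPosDef c ∧
    (∃! φL : ℕ → QOPUC.MatPoly, QOPUC.IsLeftOrthonormal M φL) ∧
    (∃! φR : ℕ → QOPUC.MatPoly, QOPUC.IsRightOrthonormal M φR) ∧
    (∀ φL : ℕ → QOPUC.MatPoly, QOPUC.IsLeftOrthonormal M φL →
      ∀ n, φL n = QOPUC.PhiR i j (QOPUC.psiL c n)) ∧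
    (∀ φR : ℕ → QOPUC.MatPoly, QOPUC.IsRightOrthonormal M φR →
      ∀ n, φR n = QOPUC.PhiL i j (QOPUC.psiR c n)) := by
  have hcM : (fun n => QOPUC.chi i j (c n)) = QOPUC.moment M := funext hc
  have hcM' : (fun n => QOPUC.chi i j (c (-n))) = fun n => QOPUC.moment M (-n) :=
    funext fun n => hc (-n)
  have hstar : ∀ n, star (c n) = c (-n) := fun n =>
    QOPUC.chi_injective hi hj hij (by
      rw [QOPUC.chi_star hi hj hij, hc, hc, QOPUC.star_moment hM])
  have hstar' : ∀ n, star (c (-n)) = c (- -n) := fun n => hstar (-n)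
  have hposL := QOPUC.toeplitzForm_self_pos hi hj hij hstar fun f hf => hM'.1 f (by
    rwa [QOPUC.matNormL, QOPUC.matInnerL_eq_toeplitzForm, ← hcM])
  have hposR := QOPUC.toeplitzForm_self_pos hi hj hij hstar' fun f hf => by
    rw [← QOPUC.coeffStar_coeffStar f] at hf ⊢
    rw [hM'.2 (QOPUC.coeffStar f) (by
      rwa [QOPUC.matNormR, QOPUC.matInnerR_eq_toeplitzForm, ← hcM'])]
    simp [QOPUC.coeffStar]
  have hL : ∀ φ, QOPUC.IsLeftOrthonormal M φ ↔ φ = fun n => QOPUC.PhiR i j (QOPUC.psiL c n) := by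
    intro φ
    rw [QOPUC.isLeftOrthonormal_iff, ← hcM,
      QOPUC.isToeplitzOrthonormal_iff hi hj hij hstar hposL]
    simp only [QOPUC.PhiR_eq_map hi hj hij]
  have hR : ∀ φ, QOPUC.IsRightOrthonormal M φ ↔ φ = fun n => QOPUC.PhiL i j (QOPUC.psiR c n) := by
    intro φ
    rw [QOPUC.isRightOrthonormal_iff, ← hcM',
      QOPUC.isToeplitzOrthonormal_iff hi hj hij hstar' hposR]
    simp only [QOPUC.PhiL_eq_map hi hj hij, ← QOPUC.coeffStar_psiR hstar, funext_iff]
    refine forall_congr' fun n => ?_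
    rw [← QOPUC.coeffStar_map _ (QOPUC.chi_star hi hj hij)]
    exact (Function.LeftInverse.injective QOPUC.coeffStar_coeffStar).eq_iff
  exact ⟨QOPUC.isNontrivialPosDef_of_toeplitzForm_pos hposR,
    ⟨_, (hL _).2 rfl, fun φ h => (hL φ).1 h⟩, ⟨_, (hR _).2 rfl, fun φ h => (hR φ).1 h⟩,
    fun φ h n => congrFun ((hL φ).1 h) n, fun φ h n => congrFun ((hR φ).1 h) n⟩
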